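/- Let $\mathcal P=\mathcal P(\boldsymbol\alpha,\boldsymbol\ell)$ be a curvilinear $n$-gon, $n\ge 1$, with angles $\boldsymbol\alpha=(\alpha_1,\dots,\alpha_n)\in(0,\pi)^n$ and side lengths $\boldsymbol\ell=(\ell_1,\dots,\ell_n)\in(0,\infty)^n$, where the side of length $\ell_j$ joins the vertices $V_{j-1}$ and $V_j$ and all indices are cyclic modulo $n$. Put $\mu_\alpha=\frac{\pi^2}{2\alpha}$. An angle is exceptional if it equals $\frac{\pi}{2k}$ with $k\in\{1,2,\dots\}$; its parity is then $\mathcal O(\alpha)=\cos\mu_\alpha=(-1)^k$. For real $\sigma$ put $$\mathtt A(\alpha)=\begin{pmatrix}\csc\mu_\alpha&-\mathrm i\cot\mu_\alpha\\ \mathrm i\cot\mu_\alpha&\csc\mu_\alpha\end{pmatrix}\ (\alpha\text{ not exceptional}),\qquad \mathtt B(\ell,\sigma)=\begin{pmatrix}\mathrm e^{\mathrm i\ell\sigma}&0\\0&\mathrm e^{-\mathrm i\ell\sigma}\end{pmatrix}.$$ Quasi-eigenvalues without exceptional angles. If no $\alpha_j$ is exceptional, let $\mathtt T(\sigma)=\mathtt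 A(\alpha_n)\mathtt B(\ell_n,\sigma)\cdots\mathtt A(\alpha_1)\mathtt B(\ell_1,\sigma)$. A number $\sigma\ge0$ is a quasi-eigenvalue if $1$ is an eigenvalue of $\mathtt T(\sigma)$. The multiplicity of a quasi-eigenvalue $\sigma>0$ is the geometric multiplicity of the eigenvalue $1$ of $\mathtt T(\sigma)$; the multiplicity of the quasi-eigenvalue $\sigma=0$ (if it is one) is $1$. Quasi-eigenvalues with exceptional angles. If there are $K\ge1$ exceptional angles, the exceptional vertices $V_{E_1},\dots,V_{E_K}$ (in cyclic order, $E_0\equiv E_K$) cut the boundary into $K$ components, the $\kappa$-th one running from $V_{E_{\kappa-1}}$ to $V_{E_\kappa}$; if $K=1$, the only component runs once around the boundary from the exceptional vertex to itself. Let $\mathtt U_\kappa(\sigma)=\mathtt B(\ell_{E_\kappa},\sigma)\mathtt A(\alpha_{E_\kappa-1})\mathtt B(\ell_{E_\kappa-1},\sigma)\cdots\mathtt A(\alpha_{E_{\kappa-1}+1})\mathtt B(\ell_{E_{\kappa-1}+1},\sigma)$ be the product along the $\kappa$-th component. For an exceptional angle $\alpha$ let $\mathbf X(\alpha)=\frac1{\sqrt2}\binom{\mathrm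 e^{-\mathrm i\pi/4}}{\mathrm e^{\mathrm i\pi/4}}$ if $\mathcal O(\alpha)=1$, and $\mathbf X(\alpha)=\frac1{\sqrt2}\binom{\mathrm e^{\mathrm i\pi/4}}{\mathrm e^{-\mathrm i\pi/4}}$ if $\mathcal O(\alpha)=-1$, and let $u\cdot v=u_1\overline{v_1}+u_2\overline{v_2}$ on $\mathbb C^2$. A number $\sigma\ge0$ is a quasi-eigenvalue if for some $\kappa\in\{1,\dots,K\}$ $$\mathtt U_\kappa(\sigma)\mathbf X(\alpha_{E_{\kappa-1}})\cdot\mathbf X(\alpha_{E_\kappa})=0.\qquad(*)$$ The multiplicity of a quasi-eigenvalue $\sigma>0$ is the number of $\kappa$ for which $(*)$ holds; the multiplicity of the quasi-eigenvalue $\sigma=0$ is half the number of $\kappa\in\{1,\dots,K\}$ with $\mathcal O(\alpha_{E_{\kappa-1}})\ne\mathcal O(\alpha_{E_\kappa})$ (the number of such $\kappa$ is always even). The trigonometric polynomial. For $\boldsymbol\zeta\in\{\pm1\}^n$ let $\operatorname{Ch}(\boldsymbol\zeta)=\{j\in\{1,\dots,n\}:\zeta_j\ne\zeta_{j+1}\}$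 with $\zeta_{n+1}=\zeta_1$, and let $$F^{\mathcal P}(\sigma)=\sum_{\substack{\boldsymbol\zeta\in\{\pm1\}^n\\ \zeta_1=1}}\ \prod_{j\in\operatorname{Ch}(\boldsymbol\zeta)}\cos\Big(\frac{\pi^2}{2\alpha_j}\Big)\,\cos\big((\boldsymbol\ell\cdot\boldsymbol\zeta)\sigma\big)\;-\;\prod_{j=1}^n\sin\Big(\frac{\pi^2}{2\alpha_j}\Big),$$ where an empty product is $1$. Theorem. In either case, $\sigma\ge0$ is a quasi-eigenvalue of $\mathcal P$ if and only if $F^{\mathcal P}(\sigma)=0$. The multiplicity of a quasi-eigenvalue $\sigma>0$ equals its multiplicity as a root of $F^{\mathcal P}$, and the multiplicity of the quasi-eigenvalue $\sigma=0$ (if it is one) is half its multiplicity as a root of $F^{\mathcal P}$. -/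

import Mathlib

/-!
The Steklov quasi-eigenvalues of a curvilinear `n`-gon depend on the polygon only through its
vector of angles `α` and its vector of side lengths `ℓ`.  Vertices and sides are indexed by `Fin n`
(so the index `j : Fin n` stands for the vertex `V_{j+1}` and the side `I_{j+1}`), in cyclic order;
the side `j` joins the vertex `j - 1` to the vertex `j`.
-/

namespace SteklovPolygon

noncomputable section

/-- `μ_α = π² / (2 α)`. -/
def mu (a : ℝ) : ℝ := Real.pi ^ 2 / (2 * a)

/-- Exceptional angles: `π / (2 k)` with `k ≥ 1`. -/
def IsExceptional (a : ℝ) : Prop := ∃ k : ℕ, 0 < k ∧ a = Real.pi / (2 * (k : ℝ))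

/-- The parity of an exceptional angle `π / (2 k)`, which is `cos μ_α = (-1) ^ k`. -/
def parity (a : ℝ) : ℝ := Real.cos (mu a)

/-- Vertex transfer matrix (meaningful for a non-exceptional angle). -/
def matA (a : ℝ) : Matrix (Fin 2) (Fin 2) ℂ :=
  !![(((Real.sin (mu a))⁻¹ : ℝ) : ℂ), -Complex.I * ((Real.cot (mu a) : ℝ) : ℂ);
     Complex.I * ((Real.cot (mu a) : ℝ) : ℂ), (((Real.sin (mu a))⁻¹ : ℝ) : ℂ)]

/-- Side transfer matrix. -/
def matB (l σ : ℝ) : Matrix (Fin 2) (Fin 2) ℂ :=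
  !![Complex.exp (Complex.I * l * σ), 0; 0, Complex.exp (-(Complex.I * l * σ))]

def matC (a l σ : ℝ) : Matrix (Fin 2) (Fin 2) ℂ := matA a * matB l σ

/-- `T = C(α_n, ℓ_n, σ) ⋯ C(α_1, ℓ_1, σ)`. -/
def matT {n : ℕ} (α ℓ : Fin n → ℝ) (σ : ℝ) : Matrix (Fin 2) (Fin 2) ℂ :=
  (List.ofFn fun j : Fin n => matC (α j) (ℓ j) σ).reverse.prod

/-- The polygon has an exceptional angle. -/
def HasExceptional {n : ℕ} (α : Fin n → ℝ) : Prop := ∃ j, IsExceptional (α j)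

/-! ### Exceptional boundary components

Going round the boundary, each exceptional vertex `s` is the initial vertex of exactly one
exceptional boundary component, so the components are indexed by the exceptional vertices `s`. -/

/-- The index reached from `s` after `k` cyclic steps. -/
def cyc {n : ℕ} [NeZero n] (s : Fin n) (k : ℕ) : Fin n := Fin.ofNat n (s.val + k)

/-- The number of (non-exceptional) vertices strictly inside the component that starts at the
exceptional vertex `s`.  The infimum is over a nonempty set, since `cyc s n = s`. -/
def innerCount {n : ℕ} [NeZero n] (α : Fin n → ℝ) (s : Fin n) : ℕ :=
  sInf {k : ℕ | IsExceptional (α (cyc s (k + 1)))}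

/-- The exceptional vertex at the end of the component that starts at `s`
(it is `s` itself if there is only one exceptional vertex). -/
def nextExc {n : ℕ} [NeZero n] (α : Fin n → ℝ) (s : Fin n) : Fin n :=
  cyc s (innerCount α s + 1)

/-- `B(ℓ_{s+k+1}) A(α_{s+k}) B(ℓ_{s+k}) ⋯ A(α_{s+1}) B(ℓ_{s+1})`: transfer along the `k + 1` sides
that follow the vertex `s`, through `k` inner vertices. -/
def matU {n : ℕ} [NeZero n] (α ℓ : Fin n → ℝ) (s : Fin n) (σ : ℝ) :
    ℕ → Matrix (Fin 2) (Fin 2) ℂ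
  | 0 => matB (ℓ (cyc s 1)) σ
  | k + 1 => matB (ℓ (cyc s (k + 2))) σ * matA (α (cyc s (k + 1))) * matU α ℓ s σ k

def vecEven : Fin 2 → ℂ :=
  ![((1 / Real.sqrt 2 : ℝ) : ℂ) * Complex.exp (-(Complex.I * (Real.pi / 4))),
    ((1 / Real.sqrt 2 : ℝ) : ℂ) * Complex.exp (Complex.I * (Real.pi / 4))]

def vecOdd : Fin 2 → ℂ :=
  ![((1 / Real.sqrt 2 : ℝ) : ℂ) * Complex.exp (Complex.I * (Real.pi / 4)),
    ((1 / Real.sqrt 2 : ℝ) : ℂ) * Complex.exp (-(Complex.I * (Real.pi / 4)))]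

open Classical in
/-- `X(α)` for an exceptional angle `α`, whose parity is `1` or `-1`. -/
def vecX (a : ℝ) : Fin 2 → ℂ := if parity a = 1 then vecEven else vecOdd

/-- The dot product `u₁ conj v₁ + u₂ conj v₂` in `ℂ²`. -/
def cdot (u v : Fin 2 → ℂ) : ℂ := ∑ i, u i * (starRingEnd ℂ) (v i)

/-- `U X(α_start) · X(α_end) = 0` for the component that starts at the exceptional vertex `s`. -/
def ComponentEq {n : ℕ} [NeZero n] (α ℓ : Fin n → ℝ) (s : Fin n) (σ : ℝ) : Prop :=
  cdot ((matU α ℓ s σ (innerCount α s)).mulVec (vecX (α s))) (vecX (α (nextExc α s))) = 0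

/-! ### Quasi-eigenvalues and their multiplicities -/

open Classical in
def IsQuasiEigenvalue {n : ℕ} [NeZero n] (α ℓ : Fin n → ℝ) (σ : ℝ) : Prop :=
  0 ≤ σ ∧
    if HasExceptional α then ∃ s, IsExceptional (α s) ∧ ComponentEq α ℓ s σ
    else Module.End.HasEigenvalue (Matrix.toLin' (matT α ℓ σ)) 1

/-- The number of components whose two exceptional end vertices have different parities, that is,
the number of sign changes in the cyclic sequence of parities (hence always an even number). -/
def oddComponents {n : ℕ} [NeZero n] (α : Fin n → ℝ) : ℕ :=
  {s : Fin n | IsExceptional (α s) ∧ parity (α s) ≠ parity (α (nextExc α s))}.ncard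

open Classical in
/-- Multiplicity of a quasi-eigenvalue `σ ≥ 0`. -/
def quasiMultiplicity {n : ℕ} [NeZero n] (α ℓ : Fin n → ℝ) (σ : ℝ) : ℕ :=
  if HasExceptional α then
    if σ = 0 then oddComponents α / 2
    else {s : Fin n | IsExceptional (α s) ∧ ComponentEq α ℓ s σ}.ncard
  else
    if σ = 0 then 1
    else Module.finrank ℂ (Module.End.eigenspace (Matrix.toLin' (matT α ℓ σ)) 1)

/-! ### The trigonometric polynomial -/

/-- Indices of cyclic sign changes of `ζ ∈ {±1}ⁿ` (here `j + 1` is taken modulo `n`). -/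
def changes {n : ℕ} [NeZero n] (ζ : Fin n → ℤˣ) : Finset (Fin n) :=
  Finset.univ.filter fun j => ζ j ≠ ζ (j + 1)

def pCoeff {n : ℕ} [NeZero n] (α : Fin n → ℝ) (ζ : Fin n → ℤˣ) : ℝ :=
  ∏ j ∈ changes ζ, Real.cos (mu (α j))

def Feven {n : ℕ} [NeZero n] (α ℓ : Fin n → ℝ) (σ : ℝ) : ℝ :=
  ∑ ζ ∈ Finset.univ.filter (fun ζ : Fin n → ℤˣ => ζ 0 = 1),
    pCoeff α ζ * Real.cos ((∑ j, ℓ j * (((ζ j : ℤˣ) : ℤ) : ℝ)) * σ)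

/-- `F^P = F_even - ∏ sin (π² / (2 α_j))`. -/
def FP {n : ℕ} [NeZero n] (α ℓ : Fin n → ℝ) (σ : ℝ) : ℝ :=
  Feven α ℓ σ - ∏ j, Real.sin (mu (α j))

end

end SteklovPolygon

namespace SteklovPolygon

open Matrix

section PathSum

variable {ι R : Type*} [Fintype ι] [DecidableEq ι] [CommSemiring R]

/-- An entry of a product of matrices is a sum over paths with prescribed endpoints. -/
lemma reverse_prod_ofFn_apply {n : ℕ} (f : Fin n → Matrix ι ι R) (x y : ι) :
    (List.ofFn f).reverse.prod x y = ∑ ζ : Fin (n + 1) → ι,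
      if ζ 0 = y ∧ ζ (Fin.last n) = x then ∏ j, f j (ζ j.succ) (ζ j.castSucc) else 0 := by
  induction n generalizing x with
  | zero =>
    calc (1 : Matrix ι ι R) x y = ∑ a : ι, if a = y ∧ a = x then (1 : R) else 0 := by
          simp [ite_and, Matrix.one_apply, eq_comm]
      _ = _ := Fintype.sum_equiv (Equiv.funUnique (Fin 1) ι).symm _ _ fun a => by simp
  | succ n ih =>
    rw [List.ofFn_succ_last, List.reverse_append, List.prod_append]
    simp only [List.reverse_cons, List.reverse_nil, List.nil_append, List.prod_cons, List.prod_nil,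
      mul_one, Matrix.mul_apply, ih, Finset.mul_sum]
    rw [Finset.sum_comm]
    conv_rhs => rw [← (Fin.snocEquiv fun _ => ι).sum_comp, Fintype.sum_prod_type, Finset.sum_comm]
    refine Finset.sum_congr rfl fun ζ _ => ?_
    simp only [Fin.snocEquiv_apply, Fin.prod_univ_castSucc, Fin.snoc_last, Fin.succ_last,
      Fin.snoc_castSucc, ← Fin.castSucc_zero, Fin.succ_castSucc, Nat.succ_eq_add_one]
    by_cases h : ζ 0 = y <;> simp [h, mul_comm]

/-- The trace of a product of matrices is a sum over closed paths. -/
lemma trace_reverse_prod_ofFn {n : ℕ} [NeZero n] (f : Fin n → Matrix ι ι R) :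
    (List.ofFn f).reverse.prod.trace = ∑ ζ : Fin n → ι, ∏ j, f j (ζ (j + 1)) (ζ j) := by
  obtain _ | m := n
  · exact absurd rfl (NeZero.ne 0)
  simp only [Matrix.trace, Matrix.diag_apply, reverse_prod_ofFn_apply]
  rw [Finset.sum_comm, ← (Fin.snocEquiv fun _ => ι).sum_comp, Fintype.sum_prod_type,
    Finset.sum_comm]
  refine Finset.sum_congr rfl fun ζ _ => ?_
  have h0 : ∀ z, (Fin.snoc ζ z : Fin (m + 2) → ι) 0 = ζ 0 := fun z => by
    rw [← Fin.castSucc_zero, Fin.snoc_castSucc]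
  simp only [Fin.snocEquiv_apply, Fin.snoc_last, h0, Fin.snoc_castSucc]
  rw [Finset.sum_eq_single (ζ 0)]
  · rw [Finset.sum_eq_single (ζ 0)]
    · simp only [and_self, if_true]
      refine Finset.prod_congr rfl fun j _ => ?_
      congr 1
      refine Fin.lastCases ?_ (fun j => ?_) j
      · rw [Fin.succ_last, Fin.snoc_last]; simp
      · rw [Fin.succ_castSucc, Fin.snoc_castSucc]; simp
    · intro x _ hx
      rw [if_neg]
      exact fun h => hx h.1.symm
    · simp
  · intro z _ hz
    refine Finset.sum_eq_zero fun x _ => if_neg fun h => hz (h.2.trans h.1.symm)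
  · simp

end PathSum

section Trace

/-- Rotation of the plane by the angle `t`. -/
noncomputable def rot (t : ℝ) : Matrix (Fin 2) (Fin 2) ℝ :=
  !![Real.cos t, -Real.sin t; Real.sin t, Real.cos t]

/-- The vertex matrix `sin μ • A`, in the basis `vecEven`, `vecOdd`. -/
noncomputable def dil (a : ℝ) : Matrix (Fin 2) (Fin 2) ℝ :=
  !![1 + Real.cos (mu a), 0; 0, 1 - Real.cos (mu a)]

/-- The matrix `sin μ • C`, in the basis `vecEven`, `vecOdd`. -/
noncomputable def realStep (a l σ : ℝ) : Matrix (Fin 2) (Fin 2) ℝ := dil a * rot (l * σ)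

/-- A matrix similar to `sin μ • C`, indexed by signs. -/
noncomputable def signStep (a l σ : ℝ) : Matrix ℤˣ ℤˣ ℂ :=
  .of fun z w => (if w ≠ z then (Real.cos (mu a) : ℂ) else 1) *
    Complex.exp (((l * ((w : ℤ) : ℝ) * σ : ℝ) : ℂ) * Complex.I)

/-- Change of basis between the sign basis and `vecEven`, `vecOdd`. -/
noncomputable def signBasis : Matrix ℤˣ (Fin 2) ℂ :=
  .of fun z => ![1, Complex.I * ((z : ℤ) : ℂ)]

noncomputable def signBasisInv : Matrix (Fin 2) ℤˣ ℂ :=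
  .of ![fun _ => 1 / 2, fun z => -Complex.I * ((z : ℤ) : ℂ) / 2]

lemma signBasis_mul_inv : signBasis * signBasisInv = 1 := by
  ext z w
  rcases Int.units_eq_one_or z with rfl | rfl <;> rcases Int.units_eq_one_or w with rfl | rfl <;>
    simp [Matrix.mul_apply, signBasis, signBasisInv, Fin.sum_univ_two] <;>
    ring_nf <;> simp <;> norm_num

lemma signBasisInv_mul : signBasisInv * signBasis = 1 := by
  ext z w
  fin_cases z <;> fin_cases w <;>
    simp [Matrix.mul_apply, signBasis, signBasisInv] <;>
    (ring_nf; try simp)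

lemma signStep_mul_signBasis (a l σ : ℝ) :
    signStep a l σ * signBasis = signBasis * (realStep a l σ).map Complex.ofReal := by
  have h1 := Complex.exp_mul_I ((l : ℂ) * σ)
  have h2 := Complex.exp_mul_I (-((l : ℂ) * σ))
  rw [Complex.cos_neg, Complex.sin_neg] at h2
  rw [neg_mul] at h2
  ext z w
  rcases Int.units_eq_one_or z with rfl | rfl <;> fin_cases w <;>
    simp [Matrix.mul_apply, signBasis, signStep, realStep, dil, rot, h1, h2,
      Fin.sum_univ_two] <;>
    ring_nf <;> simp <;> ring

lemma mul_list_prod_of_semiconj {m n R : Type*} [Fintype m] [Fintype n] [DecidableEq m]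
    [DecidableEq n] [Semiring R] (P : Matrix m n R) {β : Type*} (f : β → Matrix m m R)
    (g : β → Matrix n n R) (h : ∀ b, f b * P = P * g b) (L : List β) :
    (L.map f).prod * P = P * (L.map g).prod := by
  induction L with
  | nil => simp
  | cons b L ih => simp [Matrix.mul_assoc, ih, ← h b, ← Matrix.mul_assoc P]

lemma reverse_ofFn_eq_map {n : ℕ} {M : Type*} (f : Fin n → M) :
    (List.ofFn f).reverse = (List.finRange n).reverse.map f := by
  rw [List.ofFn_eq_map, List.map_reverse]

lemma prod_signStep {n : ℕ} [NeZero n] (α ℓ : Fin n → ℝ) (σ : ℝ) (ζ : Fin n → ℤˣ) :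
    ∏ j, signStep (α j) (ℓ j) σ (ζ (j + 1)) (ζ j) = (pCoeff α ζ : ℂ) *
      Complex.exp ((((∑ j, ℓ j * (((ζ j : ℤˣ) : ℤ) : ℝ)) * σ : ℝ) : ℂ) * Complex.I) := by
  simp only [signStep, Matrix.of_apply, Finset.prod_mul_distrib, ← Complex.exp_sum]
  congr 1
  · rw [pCoeff, changes, Finset.prod_filter]
    push_cast
    exact Finset.prod_congr rfl fun j _ => by split_ifs <;> simp
  · push_cast
    simp only [Finset.sum_mul]

lemma pCoeff_neg {n : ℕ} [NeZero n] (α : Fin n → ℝ) (ζ : Fin n → ℤˣ) :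
    pCoeff α (-ζ) = pCoeff α ζ := by
  simp [pCoeff, changes]

/-- The even part of the trigonometric polynomial is half the trace of the unnormalised transfer
matrix. -/
lemma trace_realStep {n : ℕ} [NeZero n] (α ℓ : Fin n → ℝ) (σ : ℝ) :
    (List.ofFn fun j => realStep (α j) (ℓ j) σ).reverse.prod.trace = 2 * Feven α ℓ σ := by
  have hsim : (((List.ofFn fun j => realStep (α j) (ℓ j) σ).reverse.prod.trace : ℝ) : ℂ) =
      (List.ofFn fun j => signStep (α j) (ℓ j) σ).reverse.prod.trace := by
    rw [reverse_ofFn_eq_map, reverse_ofFn_eq_map]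
    have h := mul_list_prod_of_semiconj signBasis (fun j => signStep (α j) (ℓ j) σ)
      (fun j => (realStep (α j) (ℓ j) σ).map Complex.ofReal)
      (fun j => signStep_mul_signBasis _ _ _) (List.finRange n).reverse
    rw [← mul_one (List.map (fun j => signStep (α j) (ℓ j) σ) _).prod, ← signBasis_mul_inv,
      ← Matrix.mul_assoc, h, Matrix.trace_mul_comm, ← Matrix.mul_assoc, signBasisInv_mul, one_mul]
    have h2 := map_list_prod (Complex.ofRealHom.mapMatrix (m := Fin 2))
      ((List.finRange n).reverse.map fun j => realStep (α j) (ℓ j) σ)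
    rw [List.map_map] at h2
    change _ = ((List.finRange n).reverse.map
      (Complex.ofRealHom.mapMatrix ∘ fun j => realStep (α j) (ℓ j) σ)).prod.trace
    rw [← h2, RingHom.mapMatrix_apply]
    simp [Matrix.trace]
  have key : (List.ofFn fun j => realStep (α j) (ℓ j) σ).reverse.prod.trace =
      ∑ ζ : Fin n → ℤˣ, pCoeff α ζ * Real.cos ((∑ j, ℓ j * (((ζ j : ℤˣ) : ℤ) : ℝ)) * σ) := by
    rw [trace_reverse_prod_ofFn (fun j => signStep (α j) (ℓ j) σ)] at hsim
    simp only [prod_signStep] at hsim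
    have := congrArg Complex.re hsim
    rw [Complex.ofReal_re, Complex.re_sum] at this
    simpa only [Complex.re_ofReal_mul, Complex.exp_ofReal_mul_I_re] using this
  rw [key, Feven, two_mul, ← Finset.sum_filter_add_sum_filter_not Finset.univ
    (fun ζ : Fin n → ℤˣ => ζ 0 = 1)]
  congr 1
  refine Finset.sum_nbij' (fun ζ => -ζ) (fun ζ => -ζ) ?_ ?_ ?_ ?_ ?_
  · intro ζ h
    simp only [Finset.mem_filter, Finset.mem_univ, true_and] at h ⊢
    rcases Int.units_eq_one_or (ζ 0) with h' | h'
    · exact absurd h' h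
    · simp [h']
  · intro ζ h
    simp only [Finset.mem_filter, Finset.mem_univ, true_and] at h ⊢
    simp [h]
  · simp
  · simp
  · intro ζ _
    rw [pCoeff_neg]
    simp [Finset.sum_neg_distrib]

end Trace

section Turning

/-- The angular velocity of a plane curve, times the square of its distance from the origin. -/
noncomputable def areaRate (w : ℝ → Fin 2 → ℝ) (σ : ℝ) : ℝ :=
  w σ 0 * deriv (fun t => w t 1) σ - w σ 1 * deriv (fun t => w t 0) σ

/-- An analytic plane curve avoiding the origin which never turns clockwise about it. -/
structure WeaklyTurning (w : ℝ → Fin 2 → ℝ) : Prop where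
  analytic : ∀ i σ, AnalyticAt ℝ (fun t => w t i) σ
  areaRate_nonneg : ∀ σ, 0 ≤ areaRate w σ
  ne_zero : ∀ σ, w σ ≠ 0

/-- An analytic plane curve which turns strictly anticlockwise about the origin. -/
structure Turning (w : ℝ → Fin 2 → ℝ) : Prop where
  analytic : ∀ i σ, AnalyticAt ℝ (fun t => w t i) σ
  areaRate_pos : ∀ σ, 0 < areaRate w σ

lemma Turning.weaklyTurning {w : ℝ → Fin 2 → ℝ} (h : Turning w) : WeaklyTurning w where
  analytic := h.analytic
  areaRate_nonneg σ := (h.areaRate_pos σ).le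
  ne_zero σ h0 := by simpa [areaRate, h0] using h.areaRate_pos σ

lemma weaklyTurning_const {x : Fin 2 → ℝ} (hx : x ≠ 0) : WeaklyTurning fun _ => x where
  analytic _ _ := analyticAt_const
  areaRate_nonneg σ := by simp [areaRate]
  ne_zero _ := hx

lemma rot_mulVec_zero (t : ℝ) (x : Fin 2 → ℝ) :
    (rot t *ᵥ x) 0 = Real.cos t * x 0 - Real.sin t * x 1 := by
  simp [rot, Matrix.mulVec, dotProduct, Fin.sum_univ_two]; ring

lemma rot_mulVec_one (t : ℝ) (x : Fin 2 → ℝ) :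
    (rot t *ᵥ x) 1 = Real.sin t * x 0 + Real.cos t * x 1 := by
  simp [rot, Matrix.mulVec, dotProduct, Fin.sum_univ_two]

lemma dil_mulVec_zero (a : ℝ) (x : Fin 2 → ℝ) :
    (dil a *ᵥ x) 0 = (1 + Real.cos (mu a)) * x 0 := by
  simp [dil, Matrix.mulVec, dotProduct, Fin.sum_univ_two]

lemma dil_mulVec_one (a : ℝ) (x : Fin 2 → ℝ) :
    (dil a *ᵥ x) 1 = (1 - Real.cos (mu a)) * x 1 := by
  simp [dil, Matrix.mulVec, dotProduct, Fin.sum_univ_two]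

lemma WeaklyTurning.rot {w : ℝ → Fin 2 → ℝ} (h : WeaklyTurning w) {l : ℝ} (hl : 0 < l) :
    Turning fun σ => rot (l * σ) *ᵥ w σ := by
  have hlin : ∀ σ, HasDerivAt (fun t : ℝ => l * t) l σ := fun σ => by
    simpa using (hasDerivAt_id σ).const_mul l
  have hlan : ∀ σ, AnalyticAt ℝ (fun t : ℝ => l * t) σ := fun σ =>
    analyticAt_const.mul analyticAt_id
  have hcan : ∀ σ, AnalyticAt ℝ (fun t : ℝ => Real.cos (l * t)) σ := fun σ =>
    (Real.analyticAt_cos (x := l * σ)).comp (hlan σ)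
  have hsan : ∀ σ, AnalyticAt ℝ (fun t : ℝ => Real.sin (l * t)) σ := fun σ =>
    (Real.analyticAt_sin (x := l * σ)).comp (hlan σ)
  constructor
  · intro i σ
    fin_cases i
    · simp only [Fin.zero_eta, rot_mulVec_zero]
      exact ((hcan σ).mul (h.analytic 0 σ)).sub ((hsan σ).mul (h.analytic 1 σ))
    · simp only [Fin.mk_one, rot_mulVec_one]
      exact ((hsan σ).mul (h.analytic 0 σ)).add ((hcan σ).mul (h.analytic 1 σ))
  · intro σ
    have d0 := (h.analytic 0 σ).differentiableAt.hasDerivAt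
    have d1 := (h.analytic 1 σ).differentiableAt.hasDerivAt
    have e0 := ((hlin σ).cos.mul d0).sub ((hlin σ).sin.mul d1)
    have e1 := ((hlin σ).sin.mul d0).add ((hlin σ).cos.mul d1)
    have hpos : 0 < w σ 0 ^ 2 + w σ 1 ^ 2 := by
      by_contra hcon
      apply h.ne_zero σ
      have h0 : w σ 0 = 0 := by nlinarith [sq_nonneg (w σ 0), sq_nonneg (w σ 1)]
      have h1 : w σ 1 = 0 := by nlinarith [sq_nonneg (w σ 0), sq_nonneg (w σ 1)]
      ext i
      fin_cases i <;> simp [h0, h1]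
    have hn := h.areaRate_nonneg σ
    rw [areaRate] at hn ⊢
    simp only [rot_mulVec_zero, rot_mulVec_one]
    erw [e0.deriv, e1.deriv]
    have key := Real.sin_sq_add_cos_sq (l * σ)
    set c := Real.cos (l * σ)
    set s := Real.sin (l * σ)
    set u := w σ 0
    set v := w σ 1
    set u' := deriv (fun t => w t 0) σ
    set v' := deriv (fun t => w t 1) σ
    have : 0 < (s ^ 2 + c ^ 2) * (l * (s ^ 2 + c ^ 2) * (u ^ 2 + v ^ 2)) +
        (s ^ 2 + c ^ 2) * (u * v' - v * u') := by
      rw [key]; nlinarith [mul_pos hl hpos]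
    calc 0 < _ := this
      _ = l * (u ^ 2 + v ^ 2) * (s ^ 2 + c ^ 2) * (s ^ 2 + c ^ 2) +
        (s ^ 2 + c ^ 2) * (u * v' - v * u') := by ring
      _ = l * (u ^ 2 + v ^ 2) * (s ^ 2 + c ^ 2) +
        (s ^ 2 + c ^ 2) * (u * v' - v * u') := by rw [key]; ring
      _ = _ := by ring

lemma Turning.dil {w : ℝ → Fin 2 → ℝ} (h : Turning w) {a : ℝ} (ha : Real.sin (mu a) ≠ 0) :
    Turning fun σ => dil a *ᵥ w σ := by
  constructor
  · intro i σ
    fin_cases i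
    · simp only [Fin.zero_eta, dil_mulVec_zero]
      exact analyticAt_const.mul (h.analytic 0 σ)
    · simp only [Fin.mk_one, dil_mulVec_one]
      exact analyticAt_const.mul (h.analytic 1 σ)
  · intro σ
    have hp := h.areaRate_pos σ
    rw [areaRate] at hp ⊢
    simp only [dil_mulVec_zero, dil_mulVec_one]
    rw [deriv_const_mul _ (h.analytic 0 σ).differentiableAt,
      deriv_const_mul _ (h.analytic 1 σ).differentiableAt]
    have hs : 0 < Real.sin (mu a) ^ 2 := by positivity
    have : 0 < Real.sin (mu a) ^ 2 *
      (w σ 0 * deriv (fun t => w t 1) σ - w σ 1 * deriv (fun t => w t 0) σ) := mul_pos hs hp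
    rw [Real.sin_sq] at this
    linarith

/-- The coordinates of a turning curve have only simple zeros. -/
lemma Turning.analyticOrderAt_eq_one {w : ℝ → Fin 2 → ℝ} (h : Turning w) {i : Fin 2} {σ : ℝ}
    (h0 : w σ i = 0) : analyticOrderAt (fun t => w t i) σ = 1 := by
  refine (h.analytic i σ).analyticOrderAt_eq_one_of_zero_deriv_ne_zero h0 fun h1 => ?_
  have hp := h.areaRate_pos σ
  rw [areaRate] at hp
  fin_cases i
  · simp only [Fin.zero_eta] at h0 h1
    simp [h0, h1] at hp
  · simp only [Fin.mk_one] at h0 h1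
    simp [h0, h1] at hp

end Turning

section Unimodular

variable {S : ℝ → Matrix (Fin 2) (Fin 2) ℝ}

lemma mulVec_eq_coords (M : Matrix (Fin 2) (Fin 2) ℝ) (x : Fin 2 → ℝ) (i : Fin 2) :
    (M *ᵥ x) i = M i 0 * x 0 + M i 1 * x 1 := by
  simp [Matrix.mulVec, dotProduct, Fin.sum_univ_two]

lemma analyticAt_entry (hT : ∀ x ≠ 0, Turning fun t => S t *ᵥ x) (i j : Fin 2) (σ : ℝ) :
    AnalyticAt ℝ (fun t => S t i j) σ := by
  have := (hT (Pi.single j 1) (by simp)).analytic i σ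
  simpa using this

lemma areaRate_mulVec (hT : ∀ x ≠ 0, Turning fun t => S t *ᵥ x) (σ : ℝ) (x : Fin 2 → ℝ) :
    areaRate (fun t => S t *ᵥ x) σ =
      (S σ 0 0 * x 0 + S σ 0 1 * x 1) *
        (deriv (fun t => S t 1 0) σ * x 0 + deriv (fun t => S t 1 1) σ * x 1) -
      (S σ 1 0 * x 0 + S σ 1 1 * x 1) *
        (deriv (fun t => S t 0 0) σ * x 0 + deriv (fun t => S t 0 1) σ * x 1) := by
  have d := fun i j => (analyticAt_entry hT i j σ).differentiableAt.hasDerivAt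
  have e := fun i => ((d i 0).mul_const (x 0)).add ((d i 1).mul_const (x 1))
  simp only [areaRate, mulVec_eq_coords]
  erw [(e 0).deriv, (e 1).deriv]

lemma deriv_det (hT : ∀ x ≠ 0, Turning fun t => S t *ᵥ x) (hdet : ∀ t, (S t).det = 1) (σ : ℝ) :
    deriv (fun t => S t 0 0) σ * S σ 1 1 + S σ 0 0 * deriv (fun t => S t 1 1) σ -
      (deriv (fun t => S t 0 1) σ * S σ 1 0 + S σ 0 1 * deriv (fun t => S t 1 0) σ) = 0 := by
  have d := fun i j => (analyticAt_entry hT i j σ).differentiableAt.hasDerivAt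
  have e := ((d 0 0).mul (d 1 1)).sub ((d 0 1).mul (d 1 0))
  have hc : ((fun t => S t 0 0) * (fun t => S t 1 1) - (fun t => S t 0 1) * (fun t => S t 1 0)) =
      fun _ => (1 : ℝ) := by
    ext t
    simpa [Matrix.det_fin_two] using hdet t
  rw [hc] at e
  exact e.unique (hasDerivAt_const σ 1)

/-- A unimodular matrix curve which turns every vector: where the trace is `2` and the matrix is not
the identity, the trace crosses the value `2` transversally. -/
lemma analyticOrderAt_trace_of_ne_one (hT : ∀ x ≠ 0, Turning fun t => S t *ᵥ x)
    (hdet : ∀ t, (S t).det = 1) {σ : ℝ} (htr : (S σ).trace = 2) (hne : S σ ≠ 1) :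
    analyticOrderAt (fun t => (S t).trace - 2) σ = 1 := by
  have han := fun i j => analyticAt_entry hT i j σ
  have d := fun i j => (han i j).differentiableAt.hasDerivAt
  simp only [Matrix.trace_fin_two] at htr ⊢
  refine AnalyticAt.analyticOrderAt_eq_one_of_zero_deriv_ne_zero
    (((han 0 0).add (han 1 1)).sub analyticAt_const) (by simp [htr]) ?_
  erw [(((d 0 0).add (d 1 1)).sub_const 2).deriv]
  intro h0
  have hdd := deriv_det hT hdet σ
  have hd := hdet σ
  rw [Matrix.det_fin_two] at hd
  have hpos := fun (x : Fin 2 → ℝ) (hx : x ≠ 0) =>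
    areaRate_mulVec hT σ x ▸ (hT x hx).areaRate_pos σ
  set a := S σ 0 0 with ha
  set b := S σ 0 1 with hb
  set c := S σ 1 0 with hc
  set e := S σ 1 1 with he
  set a' := deriv (fun t => S t 0 0) σ
  set b' := deriv (fun t => S t 0 1) σ
  set c' := deriv (fun t => S t 1 0) σ
  set e' := deriv (fun t => S t 1 1) σ
  have he' : e' = -a' := by linarith
  have hm : e = 2 - a := by linarith
  rw [hm] at hd
  simp only [hm, he'] at hdd hpos
  have hbc : b * c = -(a - 1) ^ 2 := by linarith
  by_cases hb0 : b = 0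
  · by_cases hc0 : c = 0
    · apply hne
      have ha1 : a = 1 := by
        rw [hb0] at hbc
        have : (a - 1) ^ 2 = 0 := by linarith
        have := pow_eq_zero_iff (two_ne_zero) |>.1 this
        linarith
      ext i j
      fin_cases i <;> fin_cases j <;> simp [← ha, ← hb, ← hc, ← he, hb0, hc0, hm, ha1] <;> norm_num
    · have := hpos ![a - 1, c] (fun h => hc0 (by simpa using congrFun h 1))
      simp only [Matrix.cons_val_zero, Matrix.cons_val_one] at this
      have ha1 : a = 1 := by
        rw [hb0] at hbc
        have : (a - 1) ^ 2 = 0 := by linarith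
        have := pow_eq_zero_iff (two_ne_zero) |>.1 this
        linarith
      rw [hb0, ha1] at this hdd
      have : c * (b' * c) < 0 := by linarith
      have h2 : b' * c = 0 := by linarith
      rw [h2] at this
      linarith
  · have := hpos ![b, 1 - a] (fun h => hb0 (by simpa using congrFun h 0))
    simp only [Matrix.cons_val_zero, Matrix.cons_val_one] at this
    have e1 : b * c' + 2 * a' * (a - 1) + c * b' = 0 := by linarith
    refine lt_irrefl (0 : ℝ) (this.trans_eq ?_)
    linear_combination (-(a' * b + b' * (1 - a)) - b') * hbc + b * e1

/-- A unimodular matrix curve which turns every vector: where the matrix is the identity, the trace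
takes the value `2` to second order. -/
lemma analyticOrderAt_trace_of_eq_one (hT : ∀ x ≠ 0, Turning fun t => S t *ᵥ x)
    (hdet : ∀ t, (S t).det = 1) {σ : ℝ} (h1 : S σ = 1) :
    analyticOrderAt (fun t => (S t).trace - 2) σ = 2 := by
  have han := fun i j t => analyticAt_entry hT i j t
  have d := fun i j t => (han i j t).differentiableAt.hasDerivAt
  have d2 := fun i j => (han i j σ).deriv.differentiableAt.hasDerivAt
  have hf : AnalyticAt ℝ (fun t => (S t).trace - 2) σ := by
    simp only [Matrix.trace_fin_two]
    exact ((han 0 0 σ).add (han 1 1 σ)).sub analyticAt_const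
  have hder : deriv (fun t => (S t).trace - 2) =
      deriv (fun t => S t 0 0) + deriv (fun t => S t 1 1) := by
    ext t
    simp only [Matrix.trace_fin_two]
    erw [(((d 0 0 t).add (d 1 1 t)).sub_const 2).deriv]
    rfl
  have hdd := deriv_det hT hdet
  have hpos := fun (x : Fin 2 → ℝ) (hx : x ≠ 0) =>
    areaRate_mulVec hT σ x ▸ (hT x hx).areaRate_pos σ
  have hdd2 := ((((d2 0 0).mul (d 1 1 σ)).add ((d 0 0 σ).mul (d2 1 1))).sub
    (((d2 0 1).mul (d 1 0 σ)).add ((d 0 1 σ).mul (d2 1 0))))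
  have hc : (deriv (fun t => S t 0 0) * (fun t => S t 1 1) +
      (fun t => S t 0 0) * deriv (fun t => S t 1 1) -
      (deriv (fun t => S t 0 1) * (fun t => S t 1 0) +
      (fun t => S t 0 1) * deriv (fun t => S t 1 0))) = fun _ => (0 : ℝ) := funext hdd
  rw [hc] at hdd2
  have hdd2 := hdd2.unique (hasDerivAt_const σ 0)
  have hdd1 := hdd σ
  have h00 : S σ 0 0 = 1 := by simp [h1]
  have h01 : S σ 0 1 = 0 := by simp [h1]
  have h10 : S σ 1 0 = 0 := by simp [h1]
  have h11 : S σ 1 1 = 1 := by simp [h1]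
  rw [h00, h01, h10, h11] at hdd2 hdd1 hpos
  have hone : analyticOrderAt (deriv fun t => (S t).trace - 2) σ = 1 := by
    rw [hder]
    refine AnalyticAt.analyticOrderAt_eq_one_of_zero_deriv_ne_zero
      ((han 0 0 σ).deriv.add (han 1 1 σ).deriv) ?_ ?_
    · simp only [Pi.add_apply]; linarith
    · rw [((d2 0 0).add (d2 1 1)).deriv]
      intro h0
      set a' := deriv (fun t => S t 0 0) σ
      set b' := deriv (fun t => S t 0 1) σ
      set c' := deriv (fun t => S t 1 0) σ
      set e' := deriv (fun t => S t 1 1) σ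
      have he : e' = -a' := by linarith
      rw [he] at hpos hdd2
      have hb := hpos ![0, 1] (fun h => by simpa using congrFun h 1)
      have hx := hpos ![b', -a'] (fun h => by
        have hb0 : b' = 0 := by simpa using congrFun h 0
        simp [hb0] at hb)
      simp only [Matrix.cons_val_zero, Matrix.cons_val_one] at hb hx
      have : a' ^ 2 + b' * c' = 0 := by linarith
      have : b' * (a' ^ 2 + b' * c') = 0 := by rw [this, mul_zero]
      nlinarith
  have := hf.analyticOrderAt_deriv_add_one
  have h0 : (S σ).trace - 2 = 0 := by rw [h1]; simp [Matrix.trace_one]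
  simp only [h0, sub_zero] at this
  rw [← this, hone]
  rfl

end Unimodular

section RealBasis

lemma exp_I_mul_pi_div_four :
    Complex.exp (Complex.I * (Real.pi / 4)) = (Real.sqrt 2 / 2 : ℝ) * (1 + Complex.I) := by
  rw [mul_comm, Complex.exp_mul_I]
  have h1 : Complex.cos (Real.pi / 4) = ((Real.sqrt 2 / 2 : ℝ) : ℂ) := by
    rw [← Real.cos_pi_div_four]; push_cast; rfl
  have h2 : Complex.sin (Real.pi / 4) = ((Real.sqrt 2 / 2 : ℝ) : ℂ) := by
    rw [← Real.sin_pi_div_four]; push_cast; rfl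
  rw [h1, h2]; ring

lemma exp_neg_I_mul_pi_div_four :
    Complex.exp (-(Complex.I * (Real.pi / 4))) = (Real.sqrt 2 / 2 : ℝ) * (1 - Complex.I) := by
  have h := congrArg (starRingEnd ℂ) exp_I_mul_pi_div_four
  rw [← Complex.exp_conj] at h
  simpa [Complex.conj_ofReal, sub_eq_add_neg, map_ofNat] using h

lemma inv_sqrt_two_mul (z : ℂ) :
    ((1 / Real.sqrt 2 : ℝ) : ℂ) * ((Real.sqrt 2 / 2 : ℝ) * z) = z / 2 := by
  have h : (1 / Real.sqrt 2) * (Real.sqrt 2 / 2) = 1 / 2 := by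
    have : Real.sqrt 2 ≠ 0 := by positivity
    field_simp
  rw [← mul_assoc, ← Complex.ofReal_mul, h]
  push_cast; ring

lemma vecEven_eq : vecEven = ![(1 - Complex.I) / 2, (1 + Complex.I) / 2] := by
  rw [vecEven, exp_I_mul_pi_div_four, exp_neg_I_mul_pi_div_four, inv_sqrt_two_mul,
    inv_sqrt_two_mul]

lemma vecOdd_eq : vecOdd = ![(1 + Complex.I) / 2, (1 - Complex.I) / 2] := by
  rw [vecOdd, exp_I_mul_pi_div_four, exp_neg_I_mul_pi_div_four, inv_sqrt_two_mul,
    inv_sqrt_two_mul]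

/-- The unitary matrix with columns `vecEven` and `vecOdd`. -/
noncomputable def basisMat : Matrix (Fin 2) (Fin 2) ℂ :=
  !![(1 - Complex.I) / 2, (1 + Complex.I) / 2; (1 + Complex.I) / 2, (1 - Complex.I) / 2]

lemma basisMat_conjTranspose_mul : basisMatᴴ * basisMat = 1 := by
  have hI := Complex.I_mul_I
  ext i j
  fin_cases i <;> fin_cases j <;>
    simp [basisMat, Matrix.mul_apply, Fin.sum_univ_two, map_ofNat]
  · linear_combination (-1 / 2) * hI
  · linear_combination (1 / 2) * hI
  · linear_combination (1 / 2) * hI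
  · linear_combination (-1 / 2) * hI

lemma basisMat_mul_conjTranspose : basisMat * basisMatᴴ = 1 :=
  mul_eq_one_comm.1 basisMat_conjTranspose_mul

lemma matB_mul_basisMat (l σ : ℝ) :
    matB l σ * basisMat = basisMat * (rot (l * σ)).map Complex.ofReal := by
  have hI := Complex.I_mul_I
  have h1 := Complex.exp_mul_I ((l : ℂ) * σ)
  have h2 := Complex.exp_mul_I (-((l : ℂ) * σ))
  rw [Complex.cos_neg, Complex.sin_neg, neg_mul] at h2
  have e : Complex.I * l * σ = (l : ℂ) * σ * Complex.I := by ring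
  ext i j
  fin_cases i <;> fin_cases j <;>
    simp [basisMat, matB, rot, Matrix.mul_apply, Fin.sum_univ_two, e, h1, h2]
  · linear_combination (-Complex.sin (l * σ) / 2) * hI
  · linear_combination (Complex.sin (l * σ) / 2) * hI
  · linear_combination (-Complex.sin (l * σ) / 2) * hI
  · linear_combination (Complex.sin (l * σ) / 2) * hI

lemma matA_mul_basisMat (a : ℝ) :
    matA a * basisMat = basisMat * ((Real.sin (mu a))⁻¹ • dil a).map Complex.ofReal := by
  have hI := Complex.I_mul_I
  ext i j
  fin_cases i <;> fin_cases j <;>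
    simp [basisMat, matA, dil, Matrix.mul_apply, Fin.sum_univ_two, Real.cot_eq_cos_div_sin]
  · linear_combination (-(Complex.cos (mu a) / Complex.sin (mu a)) / 2) * hI
  · linear_combination ((Complex.cos (mu a) / Complex.sin (mu a)) / 2) * hI
  · linear_combination (-(Complex.cos (mu a) / Complex.sin (mu a)) / 2) * hI
  · linear_combination ((Complex.cos (mu a) / Complex.sin (mu a)) / 2) * hI

end RealBasis

section Transfer

variable {n : ℕ} [NeZero n]

/-- The unnormalised transfer matrix `realStep_{a+k} ⋯ realStep_{a+1}`, with cyclic indices. -/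
noncomputable def transfer (α ℓ : Fin n → ℝ) (a : ℕ) (σ : ℝ) : ℕ → Matrix (Fin 2) (Fin 2) ℝ
  | 0 => 1
  | k + 1 => realStep (α (Fin.ofNat n (a + (k + 1)))) (ℓ (Fin.ofNat n (a + (k + 1)))) σ *
      transfer α ℓ a σ k

variable (α ℓ : Fin n → ℝ)

lemma transfer_add (a : ℕ) (σ : ℝ) (m k : ℕ) :
    transfer α ℓ a σ (m + k) = transfer α ℓ (a + m) σ k * transfer α ℓ a σ m := by
  induction k with
  | zero => simp [transfer]
  | succ k ih =>
    rw [← add_assoc, transfer, ih, transfer, Matrix.mul_assoc]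
    simp only [add_assoc]

lemma ofNat_add_self (a : ℕ) : Fin.ofNat n (a + n) = Fin.ofNat n a := by
  ext; simp [Fin.ofNat]

lemma trace_transfer_succ (a : ℕ) (σ : ℝ) :
    (transfer α ℓ (a + 1) σ n).trace = (transfer α ℓ a σ n).trace := by
  obtain ⟨m, hm⟩ := Nat.exists_eq_succ_of_ne_zero (NeZero.ne n)
  have h1 : transfer α ℓ a σ n = transfer α ℓ (a + 1) σ m * transfer α ℓ a σ 1 := by
    rw [← transfer_add]
    exact congrArg _ (by omega)
  have h2 : transfer α ℓ (a + 1) σ n = transfer α ℓ a σ 1 * transfer α ℓ (a + 1) σ m := by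
    have : transfer α ℓ (a + 1) σ n = transfer α ℓ (a + 1) σ (m + 1) := congrArg _ hm
    rw [this, transfer, transfer, transfer, mul_one, show a + 1 + (m + 1) = a + 1 + n by omega,
      ofNat_add_self]
  rw [h1, h2, Matrix.trace_mul_comm]

lemma reverse_prod_ofFn_realStep (σ : ℝ) :
    (List.ofFn fun j => realStep (α j) (ℓ j) σ).reverse.prod = transfer α ℓ (n - 1) σ n := by
  have key : ∀ k : ℕ, (List.ofFn fun j : Fin k =>
      realStep (α (Fin.ofNat n j)) (ℓ (Fin.ofNat n j)) σ).reverse.prod =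
        transfer α ℓ (n - 1) σ k := by
    intro k
    induction k with
    | zero => simp [transfer]
    | succ k ih =>
      rw [List.ofFn_succ_last, List.reverse_append, List.prod_append]
      simp only [Fin.val_castSucc, ih, transfer, List.reverse_singleton, List.prod_singleton,
        Fin.val_last]
      have : n - 1 + (k + 1) = k + n := by have := NeZero.pos n; omega
      rw [this, ofNat_add_self]
  rw [← key n]
  simp

lemma trace_transfer (a : ℕ) (σ : ℝ) : (transfer α ℓ a σ n).trace = 2 * Feven α ℓ σ := by
  have key : ∀ b, (transfer α ℓ b σ n).trace = (transfer α ℓ 0 σ n).trace := by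
    intro b
    induction b with
    | zero => rfl
    | succ b ih => rw [trace_transfer_succ, ih]
  rw [key a, ← key (n - 1), ← reverse_prod_ofFn_realStep, trace_realStep]

variable {α ℓ}

lemma weaklyTurning_transfer (hℓ : ∀ j, 0 < ℓ j) {a k : ℕ}
    (hs : ∀ i < k, Real.sin (mu (α (Fin.ofNat n (a + (i + 1))))) ≠ 0) {x : Fin 2 → ℝ}
    (hx : x ≠ 0) : WeaklyTurning fun σ => transfer α ℓ a σ k *ᵥ x := by
  induction k with
  | zero => simpa [transfer] using weaklyTurning_const hx
  | succ k ih =>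
    have h := ((ih fun i hi => hs i (by omega)).rot (hℓ (Fin.ofNat n (a + (k + 1))))).dil
      (hs k (by omega))
    simpa only [transfer, realStep, Matrix.mulVec_mulVec, Matrix.mul_assoc] using h.weaklyTurning

lemma turning_transfer (hℓ : ∀ j, 0 < ℓ j) {a k : ℕ} (hk : k ≠ 0)
    (hs : ∀ i < k, Real.sin (mu (α (Fin.ofNat n (a + (i + 1))))) ≠ 0) {x : Fin 2 → ℝ}
    (hx : x ≠ 0) : Turning fun σ => transfer α ℓ a σ k *ᵥ x := by
  obtain ⟨k, rfl⟩ := Nat.exists_eq_succ_of_ne_zero hk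
  have h := ((weaklyTurning_transfer (k := k) hℓ (fun i hi => hs i (by omega)) hx).rot
    (hℓ (Fin.ofNat n (a + (k + 1))))).dil (hs k (by omega))
  simpa only [transfer, realStep, Matrix.mulVec_mulVec, Matrix.mul_assoc] using h

lemma rot_zero : rot 0 = 1 := by
  ext i j
  fin_cases i <;> fin_cases j <;> simp [rot]

/-- At `σ = 0` the transfer matrices are diagonal. -/
lemma transfer_at_zero (α ℓ : Fin n → ℝ) (a k : ℕ) :
    transfer α ℓ a 0 k = Matrix.diagonal
      ![∏ i ∈ Finset.range k, (1 + Real.cos (mu (α (Fin.ofNat n (a + (i + 1)))))),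
        ∏ i ∈ Finset.range k, (1 - Real.cos (mu (α (Fin.ofNat n (a + (i + 1))))))] := by
  induction k with
  | zero =>
    ext i j
    fin_cases i <;> fin_cases j <;> simp [transfer]
  | succ k ih =>
    rw [transfer, ih, realStep, mul_zero, rot_zero, mul_one, Finset.prod_range_succ,
      Finset.prod_range_succ]
    ext i j
    fin_cases i <;> fin_cases j <;> simp [dil, Matrix.mul_apply, Fin.sum_univ_two, mul_comm]

end Transfer

section Angles

lemma isExceptional_iff {a : ℝ} (ha : 0 < a) : IsExceptional a ↔ Real.sin (mu a) = 0 := by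
  have hpi := Real.pi_pos
  constructor
  · rintro ⟨k, hk, rfl⟩
    have hk' : (k : ℝ) ≠ 0 := by positivity
    have : mu (Real.pi / (2 * k)) = k * Real.pi := by rw [mu]; field_simp
    rw [this, Real.sin_nat_mul_pi]
  · intro h
    obtain ⟨m, hm⟩ := Real.sin_eq_zero_iff.1 h
    have hmu : 0 < mu a := by rw [mu]; positivity
    have hm0 : 0 < m := by
      rw [← hm] at hmu
      exact_mod_cast pos_of_mul_pos_left hmu hpi.le
    lift m to ℕ using hm0.le
    have hm1 : 0 < m := by exact_mod_cast hm0
    refine ⟨m, hm1, ?_⟩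
    rw [mu] at hm
    have hm' : (0 : ℝ) < m := by exact_mod_cast hm1
    push_cast at hm
    field_simp at hm ⊢
    nlinarith

lemma parity_eq_one_or {a : ℝ} (ha : Real.sin (mu a) = 0) : parity a = 1 ∨ parity a = -1 := by
  rw [parity]
  have := Real.sin_sq_add_cos_sq (mu a)
  rw [ha] at this
  exact sq_eq_sq_iff_eq_or_eq_neg.1 (by linarith)

end Angles

section NonExceptional

variable {n : ℕ} [NeZero n]

/-- The transfer matrix `T`, in the basis `vecEven`, `vecOdd`. -/
noncomputable def realT (α ℓ : Fin n → ℝ) (σ : ℝ) : Matrix (Fin 2) (Fin 2) ℝ :=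
  (∏ j, Real.sin (mu (α j)))⁻¹ • transfer α ℓ (n - 1) σ n

lemma list_prod_smul {β : Type*} (c : β → ℝ) (f : β → Matrix (Fin 2) (Fin 2) ℝ) (L : List β) :
    (L.map fun b => c b • f b).prod = (L.map c).prod • (L.map f).prod := by
  induction L with
  | nil => simp
  | cons b L ih => simp only [List.map_cons, List.prod_cons, ih, smul_mul_smul_comm]

lemma realT_eq_list_prod (α ℓ : Fin n → ℝ) (σ : ℝ) :
    realT α ℓ σ = ((List.finRange n).reverse.map fun j =>
      (Real.sin (mu (α j)))⁻¹ • realStep (α j) (ℓ j) σ).prod := by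
  rw [realT, ← reverse_prod_ofFn_realStep, list_prod_smul, reverse_ofFn_eq_map]
  congr 1
  rw [List.map_reverse, List.prod_reverse, ← Finset.prod_inv_distrib, ← List.ofFn_eq_map,
    List.prod_ofFn]

lemma det_realT {α : Fin n → ℝ} (ℓ : Fin n → ℝ) (hs : ∀ j, Real.sin (mu (α j)) ≠ 0) (σ : ℝ) :
    (realT α ℓ σ).det = 1 := by
  rw [realT_eq_list_prod]
  refine List.prod_induction (fun M : Matrix (Fin 2) (Fin 2) ℝ => M.det = 1) ?_ Matrix.det_one ?_
  · intro M N hM hN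
    rw [Matrix.det_mul, hM, hN, mul_one]
  · intro M hM
    obtain ⟨j, -, rfl⟩ := List.mem_map.1 hM
    have h1 := Real.sin_sq_add_cos_sq (ℓ j * σ)
    have h2 := Real.sin_sq_add_cos_sq (mu (α j))
    rw [Matrix.det_smul, realStep, Matrix.det_mul, dil, rot, Matrix.det_fin_two_of,
      Matrix.det_fin_two_of, Fintype.card_fin]
    have h3 : (1 + Real.cos (mu (α j))) * (1 - Real.cos (mu (α j))) - 0 * 0 =
        Real.sin (mu (α j)) ^ 2 := by linarith
    have h4 : Real.cos (ℓ j * σ) * Real.cos (ℓ j * σ) - -Real.sin (ℓ j * σ) * Real.sin (ℓ j * σ) =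
        1 := by linarith
    rw [h3, h4, mul_one, inv_pow, inv_mul_cancel₀ (pow_ne_zero 2 (hs j))]

lemma turning_realT {α ℓ : Fin n → ℝ} (hℓ : ∀ j, 0 < ℓ j) (hs : ∀ j, Real.sin (mu (α j)) ≠ 0)
    (x : Fin 2 → ℝ) (hx : x ≠ 0) : Turning fun σ => realT α ℓ σ *ᵥ x := by
  have hp : (∏ j, Real.sin (mu (α j)))⁻¹ ≠ 0 :=
    inv_ne_zero (Finset.prod_ne_zero_iff.2 fun j _ => hs j)
  have := turning_transfer (α := α) (a := n - 1) hℓ (NeZero.ne n) (fun i _ => hs _)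
    (smul_ne_zero hp hx)
  simpa only [realT, Matrix.smul_mulVec, Matrix.mulVec_smul] using this

lemma FP_eq_trace_realT {α : Fin n → ℝ} (ℓ : Fin n → ℝ) (hs : ∀ j, Real.sin (mu (α j)) ≠ 0)
    (σ : ℝ) :
    FP α ℓ σ = (∏ j, Real.sin (mu (α j))) / 2 * ((realT α ℓ σ).trace - 2) := by
  have hp : (∏ j, Real.sin (mu (α j))) ≠ 0 := Finset.prod_ne_zero_iff.2 fun j _ => hs j
  rw [FP, realT, Matrix.trace_smul, trace_transfer, smul_eq_mul]
  field_simp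

lemma matT_mul_basisMat (α ℓ : Fin n → ℝ) (σ : ℝ) :
    matT α ℓ σ * basisMat = basisMat * (realT α ℓ σ).map Complex.ofReal := by
  rw [matT, reverse_ofFn_eq_map, mul_list_prod_of_semiconj basisMat _
    (fun j => ((Real.sin (mu (α j)))⁻¹ • realStep (α j) (ℓ j) σ).map Complex.ofReal),
    realT_eq_list_prod]
  · have h2 := map_list_prod (Complex.ofRealHom.mapMatrix (m := Fin 2))
      ((List.finRange n).reverse.map fun j => (Real.sin (mu (α j)))⁻¹ • realStep (α j) (ℓ j) σ)
    rw [List.map_map] at h2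
    exact congrArg (basisMat * ·) h2.symm
  · intro j
    have h := Matrix.map_mul (L := (Real.sin (mu (α j)))⁻¹ • dil (α j)) (M := rot (ℓ j * σ))
      (f := Complex.ofRealHom)
    rw [matC, Matrix.mul_assoc, matB_mul_basisMat, ← Matrix.mul_assoc, matA_mul_basisMat,
      Matrix.mul_assoc, realStep, ← Matrix.smul_mul]
    exact congrArg (basisMat * ·) h.symm

lemma matT_eq (α ℓ : Fin n → ℝ) (σ : ℝ) :
    matT α ℓ σ = basisMat * (realT α ℓ σ).map Complex.ofReal * basisMatᴴ := by
  rw [← matT_mul_basisMat, Matrix.mul_assoc, basisMat_mul_conjTranspose, mul_one]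

lemma trace_matT (α ℓ : Fin n → ℝ) (σ : ℝ) :
    (matT α ℓ σ).trace = ((realT α ℓ σ).trace : ℂ) := by
  rw [matT_eq, Matrix.trace_mul_comm, ← Matrix.mul_assoc, basisMat_conjTranspose_mul, one_mul]
  simp [Matrix.trace]

lemma det_matT {α : Fin n → ℝ} (ℓ : Fin n → ℝ) (hs : ∀ j, Real.sin (mu (α j)) ≠ 0) (σ : ℝ) :
    (matT α ℓ σ).det = 1 := by
  rw [matT_eq, Matrix.det_mul_right_comm, basisMat_mul_conjTranspose, one_mul]
  have := Complex.ofRealHom.map_det (realT α ℓ σ)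
  rw [det_realT ℓ hs, map_one] at this
  exact this.symm

lemma matT_eq_one_iff (α ℓ : Fin n → ℝ) (σ : ℝ) : matT α ℓ σ = 1 ↔ realT α ℓ σ = 1 := by
  constructor
  · intro h
    have h1 := matT_mul_basisMat α ℓ σ
    rw [h, one_mul] at h1
    have h2 := congrArg (basisMatᴴ * ·) h1
    simp only [← Matrix.mul_assoc, basisMat_conjTranspose_mul, one_mul] at h2
    ext i j
    have h3 := congrFun (congrFun h2 i) j
    rw [Matrix.map_apply, Matrix.one_apply] at h3
    rw [Matrix.one_apply]
    split_ifs at h3 ⊢ <;> exact_mod_cast h3.symm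
  · intro h
    rw [matT_eq, h, Matrix.map_one _ Complex.ofReal_zero Complex.ofReal_one, mul_one,
      basisMat_mul_conjTranspose]

lemma hasEigenvalue_matT_iff {α : Fin n → ℝ} (ℓ : Fin n → ℝ)
    (hs : ∀ j, Real.sin (mu (α j)) ≠ 0) (σ : ℝ) :
    Module.End.HasEigenvalue (Matrix.toLin' (matT α ℓ σ)) 1 ↔ (realT α ℓ σ).trace = 2 := by
  rw [Module.End.hasEigenvalue_iff_isRoot_charpoly, Matrix.charpoly_toLin', Polynomial.IsRoot,
    Matrix.charpoly_fin_two, det_matT ℓ hs, trace_matT]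
  simp only [Polynomial.eval_add, Polynomial.eval_sub, Polynomial.eval_pow, Polynomial.eval_X,
    Polynomial.eval_mul, Polynomial.eval_C, mul_one, one_pow]
  constructor
  · intro h
    have : ((realT α ℓ σ).trace : ℂ) = ((2 : ℝ) : ℂ) := by push_cast; linear_combination -h
    exact_mod_cast this
  · intro h
    rw [h]; push_cast; ring

lemma analyticOrderAt_const_mul {c : ℝ} (hc : c ≠ 0) {f : ℝ → ℝ} {σ : ℝ}
    (hf : AnalyticAt ℝ f σ) : analyticOrderAt (fun t => c * f t) σ = analyticOrderAt f σ := by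
  have h := analyticOrderAt_mul (f := fun _ => c) (g := f) (z₀ := σ) analyticAt_const hf
  rw [(analyticAt_const (v := c)).analyticOrderAt_eq_zero.2 hc, zero_add] at h
  exact h

lemma analyticOrderAt_FP_eq_trace {α ℓ : Fin n → ℝ} (hℓ : ∀ j, 0 < ℓ j)
    (hs : ∀ j, Real.sin (mu (α j)) ≠ 0) (σ : ℝ) :
    analyticOrderAt (fun t => FP α ℓ t) σ =
      analyticOrderAt (fun t => (realT α ℓ t).trace - 2) σ := by
  have hp : (∏ j, Real.sin (mu (α j))) ≠ 0 := Finset.prod_ne_zero_iff.2 fun j _ => hs j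
  simp only [FP_eq_trace_realT ℓ hs]
  refine analyticOrderAt_const_mul (div_ne_zero hp two_ne_zero) ?_
  simp only [Matrix.trace_fin_two]
  have han := fun i j => analyticAt_entry (turning_realT hℓ hs) i j σ
  exact ((han 0 0).add (han 1 1)).sub analyticAt_const

lemma finrank_eigenspace_matT {α : Fin n → ℝ} (ℓ : Fin n → ℝ)
    (hs : ∀ j, Real.sin (mu (α j)) ≠ 0) {σ : ℝ} (htr : (realT α ℓ σ).trace = 2)
    (hne : realT α ℓ σ ≠ 1) :
    Module.finrank ℂ (Module.End.eigenspace (Matrix.toLin' (matT α ℓ σ)) 1) = 1 := by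
  have h1 : Module.End.eigenspace (Matrix.toLin' (matT α ℓ σ)) 1 ≠ ⊥ :=
    (hasEigenvalue_matT_iff ℓ hs σ).2 htr
  have h2 : Module.End.eigenspace (Matrix.toLin' (matT α ℓ σ)) 1 ≠ ⊤ := by
    intro h
    apply hne
    rw [← matT_eq_one_iff]
    apply Matrix.toLin'.injective
    refine LinearMap.ext fun v => ?_
    have hv : v ∈ Module.End.eigenspace (Matrix.toLin' (matT α ℓ σ)) 1 := h ▸ Submodule.mem_top
    rw [Module.End.mem_eigenspace_iff] at hv
    rw [hv, Matrix.toLin'_one, one_smul, LinearMap.id_apply]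
  have h3 := Submodule.finrank_lt h2
  have h4 := Submodule.one_le_finrank_iff.2 h1
  simp at h3
  omega

lemma finrank_eigenspace_matT_of_eq_one {α ℓ : Fin n → ℝ} {σ : ℝ} (h1 : realT α ℓ σ = 1) :
    Module.finrank ℂ (Module.End.eigenspace (Matrix.toLin' (matT α ℓ σ)) 1) = 2 := by
  have : Module.End.eigenspace (Matrix.toLin' (matT α ℓ σ)) 1 = ⊤ := by
    rw [(matT_eq_one_iff α ℓ σ).2 h1]
    refine Submodule.eq_top_iff'.2 fun v => ?_
    rw [Module.End.mem_eigenspace_iff, Matrix.toLin'_one, one_smul, LinearMap.id_apply]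
  rw [this, finrank_top]
  simp

lemma analyticOrderAt_FP_eq_finrank {α ℓ : Fin n → ℝ} (hℓ : ∀ j, 0 < ℓ j)
    (hs : ∀ j, Real.sin (mu (α j)) ≠ 0) {σ : ℝ} (htr : (realT α ℓ σ).trace = 2) :
    analyticOrderAt (fun t => FP α ℓ t) σ =
      Module.finrank ℂ (Module.End.eigenspace (Matrix.toLin' (matT α ℓ σ)) 1) := by
  rw [analyticOrderAt_FP_eq_trace hℓ hs]
  by_cases h1 : realT α ℓ σ = 1
  · rw [analyticOrderAt_trace_of_eq_one (turning_realT hℓ hs) (det_realT ℓ hs) h1,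
      finrank_eigenspace_matT_of_eq_one h1]
    rfl
  · rw [analyticOrderAt_trace_of_ne_one (turning_realT hℓ hs) (det_realT ℓ hs) htr h1,
      finrank_eigenspace_matT ℓ hs htr h1]
    rfl

lemma analyticOrderAt_FP_zero_of_trace {α ℓ : Fin n → ℝ} (hℓ : ∀ j, 0 < ℓ j)
    (hs : ∀ j, Real.sin (mu (α j)) ≠ 0) (htr : (realT α ℓ 0).trace = 2) :
    analyticOrderAt (fun t => FP α ℓ t) 0 = 2 := by
  rw [analyticOrderAt_FP_eq_trace hℓ hs]
  refine analyticOrderAt_trace_of_eq_one (turning_realT hℓ hs) (det_realT ℓ hs) ?_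
  have h01 : realT α ℓ 0 0 1 = 0 := by simp [realT, transfer_at_zero]
  have h10 : realT α ℓ 0 1 0 = 0 := by simp [realT, transfer_at_zero]
  have hdet := det_realT ℓ hs 0
  rw [Matrix.det_fin_two, h01, h10] at hdet
  rw [Matrix.trace_fin_two] at htr
  have h11 : realT α ℓ 0 1 1 = 2 - realT α ℓ 0 0 0 := by linarith
  rw [h11] at hdet
  have h00 : (realT α ℓ 0 0 0 - 1) ^ 2 = 0 := by linarith
  have h00 : realT α ℓ 0 0 0 = 1 := by linarith [pow_eq_zero_iff two_ne_zero |>.1 h00]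
  rw [h00] at h11
  ext i j
  fin_cases i <;> fin_cases j
  · simpa using h00
  · simpa using h01
  · simpa using h10
  · simp [h11]; norm_num

end NonExceptional

section Cyclic

variable {n : ℕ} [NeZero n]

lemma cyc_eq_add (s : Fin n) (k : ℕ) : cyc s k = s + Fin.ofNat n k := by
  ext; simp [cyc, Fin.ofNat, Fin.val_add]

lemma cyc_zero (s : Fin n) : cyc s 0 = s := by
  ext; simp [cyc, Fin.ofNat, Nat.mod_eq_of_lt]

lemma cyc_self (s : Fin n) : cyc s n = s := by
  ext; simp [cyc, Fin.ofNat, Nat.mod_eq_of_lt]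

lemma cyc_cyc (s : Fin n) (m k : ℕ) : cyc (cyc s m) k = cyc s (m + k) := by
  ext; simp [cyc, Fin.ofNat, add_assoc]

variable {α : Fin n → ℝ} {s : Fin n}

lemma isExceptional_nextExc (hs : IsExceptional (α s)) : IsExceptional (α (nextExc α s)) := by
  have hne : {k : ℕ | IsExceptional (α (cyc s (k + 1)))}.Nonempty :=
    ⟨n - 1, by simpa [Nat.sub_add_cancel (NeZero.pos n), cyc_self] using hs⟩
  exact Nat.sInf_mem hne

lemma innerCount_le {k : ℕ} (h : IsExceptional (α (cyc s (k + 1)))) : innerCount α s ≤ k :=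
  Nat.sInf_le h

lemma not_isExceptional_of_lt_innerCount {i : ℕ} (h : i < innerCount α s) :
    ¬ IsExceptional (α (cyc s (i + 1))) :=
  Nat.notMem_of_lt_sInf h

/-- Induction along the chain of exceptional vertices. -/
lemma exceptional_induction {motive : Fin n → ℕ → Prop} (zero : ∀ s, motive s 0)
    (next : ∀ s k, IsExceptional (α s) → motive (nextExc α s) k →
      motive s (innerCount α s + 1 + k))
    (k : ℕ) (s : Fin n) (hs : IsExceptional (α s)) (hk : IsExceptional (α (cyc s k))) :
    motive s k := by
  induction k using Nat.strong_induction_on generalizing s with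
  | _ k ih =>
    obtain _ | k := k
    · exact zero s
    · obtain ⟨r, hr⟩ := Nat.exists_eq_add_of_le (innerCount_le hk)
      rw [show k + 1 = innerCount α s + 1 + r by omega] at hk ⊢
      refine next s r hs (ih r (by omega) _ (isExceptional_nextExc hs) ?_)
      rwa [nextExc, cyc_cyc]

open Classical in
/-- The product of `f` over the exceptional vertices among the `k` vertices starting at `s`. -/
noncomputable def excProd (α : Fin n → ℝ) (f : Fin n → ℝ) (s : Fin n) (k : ℕ) : ℝ :=
  ∏ i ∈ Finset.range k, if IsExceptional (α (cyc s i)) then f (cyc s i) else 1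

lemma excProd_next (f : Fin n → ℝ) (hs : IsExceptional (α s)) (k : ℕ) :
    excProd α f s (innerCount α s + 1 + k) = f s * excProd α f (nextExc α s) k := by
  classical
  rw [excProd, Finset.prod_range_add, Finset.prod_range_succ', cyc_zero, if_pos hs,
    Finset.prod_eq_one, one_mul, excProd]
  · simp only [nextExc, cyc_cyc]
  · intro i hi
    exact if_neg (not_isExceptional_of_lt_innerCount (Finset.mem_range.1 hi))

open Classical in
lemma excProd_full (f : Fin n → ℝ) :
    excProd α f s n = ∏ j ∈ Finset.univ.filter fun j => IsExceptional (α j), f j := by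
  rw [excProd, Finset.prod_range, Finset.prod_filter,
    ← Equiv.prod_comp (Equiv.addLeft s) fun j => if IsExceptional (α j) then f j else 1]
  refine Finset.prod_congr rfl fun i _ => ?_
  rw [show cyc s i = s + i by simp [cyc_eq_add], Equiv.coe_addLeft]

end Cyclic

section Components

variable {n : ℕ} [NeZero n]

open Classical in
/-- The index of `X(α)` in the basis `vecEven`, `vecOdd`. -/
noncomputable def excIdx (a : ℝ) : Fin 2 := if parity a = 1 then 0 else 1

lemma dil_mulVec_of_sin_eq_zero {a : ℝ} (ha : Real.sin (mu a) = 0) (x : Fin 2 → ℝ) :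
    dil a *ᵥ x = (2 * x (excIdx a)) • Pi.single (excIdx a) 1 := by
  rcases parity_eq_one_or ha with h | h
  · have hi : excIdx a = 0 := if_pos h
    rw [parity] at h
    ext i
    fin_cases i <;> simp [dil_mulVec_zero, dil_mulVec_one, h, hi] <;> norm_num
  · have hi : excIdx a = 1 := if_neg (by rw [h]; norm_num)
    rw [parity] at h
    ext i
    fin_cases i <;> simp [dil_mulVec_zero, dil_mulVec_one, h, hi] <;> norm_num

lemma excIdx_eq_iff {a b : ℝ} (ha : Real.sin (mu a) = 0) (hb : Real.sin (mu b) = 0) :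
    excIdx a = excIdx b ↔ parity a = parity b := by
  rcases parity_eq_one_or ha with h | h <;> rcases parity_eq_one_or hb with h' | h' <;>
    norm_num [excIdx, h, h']

/-- The curve `U_κ(σ) X`, up to a constant factor, in the basis `vecEven`, `vecOdd`. -/
noncomputable def componentCurve (α ℓ : Fin n → ℝ) (s : Fin n) (σ : ℝ) : Fin 2 → ℝ :=
  rot (ℓ (nextExc α s) * σ) *ᵥ
    (transfer α ℓ s σ (innerCount α s) *ᵥ Pi.single (excIdx (α s)) 1)

/-- The function `U_κ(σ) X · X`, up to a constant factor. -/
noncomputable def componentFn (α ℓ : Fin n → ℝ) (s : Fin n) (σ : ℝ) : ℝ :=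
  componentCurve α ℓ s σ (excIdx (α (nextExc α s)))

variable {α ℓ : Fin n → ℝ} {s : Fin n}

lemma sin_ne_zero_of_lt_innerCount (hα : ∀ j, 0 < α j) {i : ℕ} (hi : i < innerCount α s) :
    Real.sin (mu (α (cyc s (i + 1)))) ≠ 0 := fun h =>
  not_isExceptional_of_lt_innerCount hi ((isExceptional_iff (hα _)).2 h)

lemma turning_componentCurve (hα : ∀ j, 0 < α j) (hℓ : ∀ j, 0 < ℓ j) :
    Turning (componentCurve α ℓ s) :=
  (weaklyTurning_transfer hℓ (fun _ hi => sin_ne_zero_of_lt_innerCount hα hi)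
    (by simp)).rot (hℓ _)

lemma transfer_nextExc (hα : ∀ j, 0 < α j) (hs : IsExceptional (α s)) (σ : ℝ) :
    transfer α ℓ s σ (innerCount α s + 1) *ᵥ Pi.single (excIdx (α s)) 1 =
      (2 * componentFn α ℓ s σ) • Pi.single (excIdx (α (nextExc α s))) 1 := by
  rw [transfer, realStep, Matrix.mul_assoc, ← Matrix.mulVec_mulVec, ← Matrix.mulVec_mulVec]
  exact dil_mulVec_of_sin_eq_zero ((isExceptional_iff (hα _)).1 (isExceptional_nextExc hs)) _

lemma transfer_val_ofNat (α ℓ : Fin n → ℝ) (a : ℕ) (σ : ℝ) (k : ℕ) :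
    transfer α ℓ (Fin.ofNat n a).val σ k = transfer α ℓ a σ k := by
  induction k with
  | zero => rfl
  | succ k ih =>
    have : Fin.ofNat n ((Fin.ofNat n a).val + (k + 1)) = Fin.ofNat n (a + (k + 1)) := by
      ext; simp [Fin.ofNat]
    rw [transfer, transfer, ih, this]

lemma transfer_mulVec_exceptional (hα : ∀ j, 0 < α j) (σ : ℝ) (k : ℕ) (s : Fin n)
    (hs : IsExceptional (α s)) (hk : IsExceptional (α (cyc s k))) :
    transfer α ℓ s σ k *ᵥ Pi.single (excIdx (α s)) 1 =
      excProd α (fun t => 2 * componentFn α ℓ t σ) s k •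
        Pi.single (excIdx (α (cyc s k))) 1 := by
  refine exceptional_induction (motive := fun s k =>
    transfer α ℓ s σ k *ᵥ Pi.single (excIdx (α s)) 1 =
      excProd α (fun t => 2 * componentFn α ℓ t σ) s k •
        Pi.single (excIdx (α (cyc s k))) 1) ?_ ?_ k s hs hk
  · intro s
    rw [transfer, excProd, Finset.prod_range_zero, cyc_zero, one_smul, Matrix.one_mulVec]
  · intro s k hs ih
    rw [transfer_add, ← Matrix.mulVec_mulVec, transfer_nextExc hα hs, Matrix.mulVec_smul,
      ← transfer_val_ofNat]
    change _ • (transfer α ℓ (nextExc α s) σ k *ᵥ _) = _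
    rw [ih, excProd_next _ hs, smul_smul]
    simp only [nextExc, cyc_cyc]

lemma trace_transfer_exceptional (hα : ∀ j, 0 < α j) (hs : IsExceptional (α s)) (σ : ℝ) :
    (transfer α ℓ s σ n).trace = excProd α (fun t => 2 * componentFn α ℓ t σ) s n := by
  have key := transfer_mulVec_exceptional (ℓ := ℓ) hα σ n s hs (by rwa [cyc_self])
  rw [cyc_self] at key
  have hcol : ∀ x, ∃ c : ℝ, transfer α ℓ s σ n *ᵥ x = c • Pi.single (excIdx (α s)) 1 := by
    intro x
    obtain ⟨m, hm⟩ := Nat.exists_eq_succ_of_ne_zero (NeZero.ne n)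
    have h1 : transfer α ℓ s σ n = transfer α ℓ s σ (m + 1) := congrArg _ hm
    have h2 : Fin.ofNat n (s.val + (m + 1)) = s := by
      have := cyc_self s
      rwa [cyc, show s.val + n = s.val + (m + 1) by omega] at this
    rw [h1, transfer, h2, realStep, Matrix.mul_assoc, ← Matrix.mulVec_mulVec]
    exact ⟨_, dil_mulVec_of_sin_eq_zero ((isExceptional_iff (hα _)).1 hs) _⟩
  generalize excIdx (α s) = e at key hcol
  rw [Matrix.trace_fin_two]
  obtain ⟨c, hc⟩ := hcol (Pi.single (1 - e) 1)
  fin_cases e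
  · have h0 := congrFun key 0
    have h1 := congrFun hc 1
    simp at h0 h1
    rw [h0, h1, add_zero]
  · have h0 := congrFun key 1
    have h1 := congrFun hc 0
    simp at h0 h1
    rw [h0, h1, zero_add]

open Classical in
/-- With exceptional angles, the trigonometric polynomial is the product of the component
functions, up to a constant factor. -/
lemma FP_eq_prod_componentFn (hα : ∀ j, 0 < α j) (h : HasExceptional α) (σ : ℝ) :
    FP α ℓ σ = 1 / 2 * ∏ j ∈ Finset.univ.filter (fun j => IsExceptional (α j)),
      (2 * componentFn α ℓ j σ) := by
  obtain ⟨s, hs⟩ := h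
  have h1 := trace_transfer α ℓ s σ
  rw [trace_transfer_exceptional hα hs, excProd_full] at h1
  rw [FP, Finset.prod_eq_zero (Finset.mem_univ s) ((isExceptional_iff (hα s)).1 hs), h1]
  ring

lemma matU_mul_basisMat (α ℓ : Fin n → ℝ) (s : Fin n) (σ : ℝ) (k : ℕ) :
    matU α ℓ s σ k * basisMat = basisMat *
      ((∏ i ∈ Finset.range k, (Real.sin (mu (α (cyc s (i + 1)))))⁻¹) •
        (rot (ℓ (cyc s (k + 1)) * σ) * transfer α ℓ s σ k)).map Complex.ofReal := by
  have hmul : ∀ M N : Matrix (Fin 2) (Fin 2) ℝ,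
      (M * N).map Complex.ofReal = M.map Complex.ofReal * N.map Complex.ofReal :=
    fun M N => Matrix.map_mul (f := Complex.ofRealHom)
  induction k with
  | zero => rw [matU, matB_mul_basisMat, Finset.prod_range_zero, one_smul, transfer, mul_one]
  | succ k ih =>
    rw [matU, Matrix.mul_assoc, ih, ← Matrix.mul_assoc, Matrix.mul_assoc _ _ basisMat,
      matA_mul_basisMat, ← Matrix.mul_assoc, matB_mul_basisMat, Matrix.mul_assoc, Matrix.mul_assoc,
      ← hmul, ← hmul, Finset.prod_range_succ, transfer, realStep]
    congr 2
    simp only [Matrix.smul_mul, Matrix.mul_smul, smul_smul, Matrix.mul_assoc]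
    rw [mul_comm]
    rfl

lemma vecX_eq (a : ℝ) : vecX a = basisMat *ᵥ Pi.single (excIdx a) 1 := by
  rw [vecX, excIdx]
  split_ifs
  · rw [vecEven_eq]
    ext i
    fin_cases i <;> simp [basisMat]
  · rw [vecOdd_eq]
    ext i
    fin_cases i <;> simp [basisMat]

lemma cdot_basisMat (u : Fin 2 → ℂ) (i : Fin 2) :
    cdot (basisMat *ᵥ u) (basisMat *ᵥ Pi.single i 1) = u i := by
  have hI := Complex.I_mul_I
  fin_cases i <;> simp [cdot, basisMat, map_ofNat, Matrix.vecHead, Matrix.vecTail]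
  · linear_combination (-u 0 / 2 + u 1 / 2) * hI
  · linear_combination (u 0 / 2 - u 1 / 2) * hI

lemma componentEq_iff (hα : ∀ j, 0 < α j) (σ : ℝ) :
    ComponentEq α ℓ s σ ↔ componentFn α ℓ s σ = 0 := by
  rw [ComponentEq, vecX_eq, vecX_eq, Matrix.mulVec_mulVec, matU_mul_basisMat,
    ← Matrix.mulVec_mulVec, cdot_basisMat]
  have hp : ∏ i ∈ Finset.range (innerCount α s), (Real.sin (mu (α (cyc s (i + 1)))))⁻¹ ≠ 0 :=
    Finset.prod_ne_zero_iff.2 fun i hi =>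
      inv_ne_zero (sin_ne_zero_of_lt_innerCount hα (Finset.mem_range.1 hi))
  have hcol : ∀ (M : Matrix (Fin 2) (Fin 2) ℝ) (c : ℝ) (i j : Fin 2),
      (((c • M).map Complex.ofReal) *ᵥ Pi.single i 1) j =
        ((c * (M *ᵥ Pi.single i 1) j : ℝ) : ℂ) := by
    intro M c i j
    simp only [Matrix.mulVec_single_one, Matrix.col_apply, Matrix.map_apply, Matrix.smul_apply,
      smul_eq_mul]
  rw [hcol, Complex.ofReal_eq_zero, mul_eq_zero, or_iff_right hp, ← Matrix.mulVec_mulVec]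
  rfl

lemma componentFn_zero_iff (hα : ∀ j, 0 < α j) (hs : IsExceptional (α s)) :
    componentFn α ℓ s 0 = 0 ↔ parity (α s) ≠ parity (α (nextExc α s)) := by
  rw [Ne, ← excIdx_eq_iff ((isExceptional_iff (hα _)).1 hs)
    ((isExceptional_iff (hα _)).1 (isExceptional_nextExc hs)), componentFn, componentCurve,
    mul_zero, rot_zero, Matrix.one_mulVec, transfer_at_zero]
  have hne : ∀ i ∈ Finset.range (innerCount α s),
      (1 + Real.cos (mu (α (cyc s (i + 1))))) * (1 - Real.cos (mu (α (cyc s (i + 1))))) ≠ 0 := by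
    intro i hi
    have h := sin_ne_zero_of_lt_innerCount hα (Finset.mem_range.1 hi)
    have h2 := Real.sin_sq_add_cos_sq (mu (α (cyc s (i + 1))))
    rw [show (1 + Real.cos (mu (α (cyc s (i + 1))))) * (1 - Real.cos (mu (α (cyc s (i + 1))))) =
      Real.sin (mu (α (cyc s (i + 1)))) ^ 2 by linarith]
    exact pow_ne_zero 2 h
  have h0 := Finset.prod_ne_zero_iff.2 fun i hi => left_ne_zero_of_mul (hne i hi)
  have h1 := Finset.prod_ne_zero_iff.2 fun i hi => right_ne_zero_of_mul (hne i hi)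
  simp only [cyc] at h0 h1
  generalize excIdx (α s) = e
  generalize excIdx (α (nextExc α s)) = e'
  rw [Matrix.mulVec_single_one, Matrix.col_apply]
  fin_cases e <;> fin_cases e' <;> simp
  · simpa [Finset.prod_eq_zero_iff] using h0
  · simpa [Finset.prod_eq_zero_iff] using h1

lemma analyticOrderAt_prod_of_simple {ι : Type*} (A : Finset ι) (f : ι → ℝ → ℝ) (σ : ℝ)
    (hf : ∀ i ∈ A, AnalyticAt ℝ (f i) σ)
    (h1 : ∀ i ∈ A, f i σ = 0 → analyticOrderAt (f i) σ = 1) :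
    analyticOrderAt (fun t => ∏ i ∈ A, f i t) σ = ((A.filter fun i => f i σ = 0).card : ℕ∞) := by
  classical
  induction A using Finset.induction_on with
  | empty =>
    have : analyticOrderAt (fun _ : ℝ => (1 : ℝ)) σ = 0 :=
      analyticAt_const.analyticOrderAt_eq_zero.2 one_ne_zero
    simpa using this
  | insert a A ha ih =>
    have hA : AnalyticAt ℝ (fun t => ∏ i ∈ A, f i t) σ := by
      have := Finset.analyticAt_prod A (f := f) fun i hi => hf i (Finset.mem_insert_of_mem hi)
      simpa [Finset.prod_fn] using this
    have hfa := hf a (Finset.mem_insert_self a A)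
    have := analyticOrderAt_mul hfa hA
    simp only [Finset.prod_insert ha]
    change analyticOrderAt (f a * fun t => ∏ i ∈ A, f i t) σ = _
    rw [this, ih (fun i hi => hf i (Finset.mem_insert_of_mem hi))
      (fun i hi => h1 i (Finset.mem_insert_of_mem hi)), Finset.filter_insert]
    split_ifs with h0
    · rw [h1 a (Finset.mem_insert_self a A) h0, Finset.card_insert_of_notMem (by simp [ha])]
      push_cast
      rw [add_comm]
    · rw [hfa.analyticOrderAt_eq_zero.2 h0, zero_add]

lemma analyticOrderAt_FP_of_hasExceptional (hα : ∀ j, 0 < α j) (hℓ : ∀ j, 0 < ℓ j)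
    (h : HasExceptional α) (σ : ℝ) :
    analyticOrderAt (fun t => FP α ℓ t) σ =
      ({s : Fin n | IsExceptional (α s) ∧ componentFn α ℓ s σ = 0}.ncard : ℕ∞) := by
  classical
  have han : ∀ j, AnalyticAt ℝ (componentFn α ℓ j) σ := fun j =>
    (turning_componentCurve hα hℓ).analytic _ σ
  have hmul : ∀ t, FP α ℓ t = 1 / 2 * 2 ^ (Finset.univ.filter fun j => IsExceptional (α j)).card *
      ∏ j ∈ Finset.univ.filter (fun j => IsExceptional (α j)), componentFn α ℓ j t := fun t => by
    rw [FP_eq_prod_componentFn hα h, Finset.prod_mul_distrib, Finset.prod_const, mul_assoc]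
  simp only [hmul]
  rw [analyticOrderAt_const_mul (by positivity), analyticOrderAt_prod_of_simple _ _ _
    (fun j _ => han j) (fun j _ h0 => (turning_componentCurve hα hℓ).analyticOrderAt_eq_one h0),
    Finset.filter_filter, ← Set.ncard_coe_finset]
  · simp
  · have := Finset.analyticAt_prod (Finset.univ.filter fun j => IsExceptional (α j))
      (f := componentFn α ℓ) fun j _ => han j
    simpa [Finset.prod_fn] using this

lemma parity_cyc (hα : ∀ j, 0 < α j) (k : ℕ) (s : Fin n) (hs : IsExceptional (α s))
    (hk : IsExceptional (α (cyc s k))) :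
    parity (α (cyc s k)) = parity (α s) *
      excProd α (fun t => parity (α t) * parity (α (nextExc α t))) s k := by
  refine exceptional_induction (motive := fun s k => parity (α (cyc s k)) = parity (α s) *
    excProd α (fun t => parity (α t) * parity (α (nextExc α t))) s k) ?_ ?_ k s hs hk
  · intro s
    rw [excProd, Finset.prod_range_zero, cyc_zero, mul_one]
  · intro s k hs ih
    rw [excProd_next _ hs]
    have h2 : parity (α s) * parity (α s) = 1 := by
      rcases parity_eq_one_or ((isExceptional_iff (hα _)).1 hs) with h | h <;> rw [h] <;> norm_num
    have h3 : cyc s (innerCount α s + 1 + k) = cyc (nextExc α s) k := by rw [nextExc, cyc_cyc]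
    rw [h3, ih]
    linear_combination -(parity (α (nextExc α s)) *
      excProd α (fun t => parity (α t) * parity (α (nextExc α t))) (nextExc α s) k) * h2

/-- The parity changes an even number of times around the boundary. -/
lemma even_oddComponents (hα : ∀ j, 0 < α j) (h : HasExceptional α) : Even (oddComponents α) := by
  classical
  obtain ⟨s, hs⟩ := h
  have h1 := parity_cyc hα n s hs (by rwa [cyc_self])
  have hp : ∀ {t}, IsExceptional (α t) → parity (α t) = 1 ∨ parity (α t) = -1 := fun ht =>
    parity_eq_one_or ((isExceptional_iff (hα _)).1 ht)
  have h0 : parity (α s) ≠ 0 := by rcases hp hs with h | h <;> rw [h] <;> norm_num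
  rw [cyc_self, excProd_full, eq_comm, mul_eq_left₀ h0] at h1
  have h2 : ∏ t ∈ Finset.univ.filter (fun t => IsExceptional (α t)),
      (parity (α t) * parity (α (nextExc α t))) =
      ∏ t ∈ Finset.univ.filter (fun t => IsExceptional (α t)),
        if parity (α t) ≠ parity (α (nextExc α t)) then (-1 : ℝ) else 1 := by
    refine Finset.prod_congr rfl fun t ht => ?_
    have ht := (Finset.mem_filter.1 ht).2
    rcases hp ht with h | h <;> rcases hp (isExceptional_nextExc ht) with h' | h' <;>
      norm_num [h, h']
  rw [h2, ← Finset.prod_filter, Finset.filter_filter, Finset.prod_const] at h1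
  have h3 : (Finset.univ.filter fun t => IsExceptional (α t) ∧
      parity (α t) ≠ parity (α (nextExc α t))).card = oddComponents α := by
    rw [oddComponents, ← Set.ncard_coe_finset]
    simp
  rw [h3] at h1
  exact (neg_one_pow_eq_one_iff_even (by norm_num)).1 h1

end Components

end SteklovPolygon

open SteklovPolygon in
theorem mainTheorem4 (n : ℕ) [NeZero n] (α ℓ : Fin n → ℝ)
    (hα : ∀ j, 0 < α j ∧ α j < Real.pi) (hℓ : ∀ j, 0 < ℓ j) :
    (∀ σ : ℝ, 0 ≤ σ →
      (SteklovPolygon.IsQuasiEigenvalue α ℓ σ ↔ SteklovPolygon.FP α ℓ σ = 0)) ∧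
    (∀ σ : ℝ, 0 < σ → SteklovPolygon.IsQuasiEigenvalue α ℓ σ →
      analyticOrderAt (fun x : ℝ => SteklovPolygon.FP α ℓ x) σ =
        (SteklovPolygon.quasiMultiplicity α ℓ σ : ℕ∞)) ∧
    (SteklovPolygon.IsQuasiEigenvalue α ℓ 0 →
      analyticOrderAt (fun x : ℝ => SteklovPolygon.FP α ℓ x) 0 =
        2 * (SteklovPolygon.quasiMultiplicity α ℓ 0 : ℕ∞)) := by
  classical
  have hpos : ∀ j, 0 < α j := fun j => (hα j).1
  by_cases hE : HasExceptional α
  · refine ⟨fun σ hσ => ?_, fun σ hσ _ => ?_, fun _ => ?_⟩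
    · rw [IsQuasiEigenvalue, if_pos hE, and_iff_right hσ, FP_eq_prod_componentFn hpos hE]
      simp only [componentEq_iff hpos, mul_eq_zero, Finset.prod_eq_zero_iff, Finset.mem_filter,
        Finset.mem_univ, true_and]
      norm_num
    · rw [analyticOrderAt_FP_of_hasExceptional hpos hℓ hE, quasiMultiplicity, if_pos hE,
        if_neg hσ.ne']
      simp only [componentEq_iff hpos]
    · rw [analyticOrderAt_FP_of_hasExceptional hpos hℓ hE, quasiMultiplicity, if_pos hE, if_pos rfl]
      have : {s : Fin n | IsExceptional (α s) ∧ componentFn α ℓ s 0 = 0}.ncard =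
          oddComponents α := by
        rw [oddComponents]
        congr 1
        ext s
        exact and_congr_right fun hs => componentFn_zero_iff hpos hs
      rw [this]
      have h2 : 2 * (oddComponents α / 2) = oddComponents α :=
        Nat.two_mul_div_two_of_even (even_oddComponents hpos hE)
      exact_mod_cast h2.symm
  · have hs : ∀ j, Real.sin (mu (α j)) ≠ 0 := fun j h =>
      hE ⟨j, (isExceptional_iff (hpos j)).2 h⟩
    have hiff : ∀ σ, IsQuasiEigenvalue α ℓ σ ↔ 0 ≤ σ ∧ (realT α ℓ σ).trace = 2 := fun σ => by
      rw [IsQuasiEigenvalue, if_neg hE, hasEigenvalue_matT_iff ℓ hs]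
    refine ⟨fun σ hσ => ?_, fun σ hσ hq => ?_, fun hq => ?_⟩
    · have hp : (∏ j, Real.sin (mu (α j))) ≠ 0 := Finset.prod_ne_zero_iff.2 fun j _ => hs j
      rw [hiff, and_iff_right hσ, FP_eq_trace_realT ℓ hs, mul_eq_zero,
        or_iff_right (div_ne_zero hp two_ne_zero), sub_eq_zero]
    · rw [analyticOrderAt_FP_eq_finrank hℓ hs ((hiff σ).1 hq).2, quasiMultiplicity, if_neg hE,
        if_neg hσ.ne']
    · rw [analyticOrderAt_FP_zero_of_trace hℓ hs ((hiff 0).1 hq).2, quasiMultiplicity, if_neg hE,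
        if_pos rfl]
      norm_num
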